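/- Let $b\in\mathbb{C}$ with $\operatorname{Re} b>-\tfrac12$, let $\mathbb{T}=\{z\in\mathbb{C}:|z|=1\}$ be positively oriented, and let $$\nu(z)=(-z)^{-\overline b}(1-z)^{b+\overline b},\qquad z\in\mathbb{T}\setminus\{1\},$$ (principal powers) be the modified Jacobi weight. With $b=\lambda+\mathrm i\eta$ one has $\nu(e^{\mathrm i\theta})=e^{-\eta(\theta-\pi)}\,(2\sin(\theta/2))^{2\lambda}>0$ for $0<\theta<2\pi$. There is exactly one sequence $(\Phi_n)_{n\ge0}$ of monic polynomials with $\deg\Phi_n=n$ and $$\int_{\mathbb{T}}\Phi_n(z)\overline{\Phi_m(z)}\,\frac{\nu(z)}{\mathrm i z}\,dz=\kappa_n^{-2}\delta_{n,m},\qquad \kappa_n>0,\quad n,m\ge0 .$$ For $n\ge1$ let $\Phi_{n-1}^*$ be the reciprocal polynomial, $\Phi_{n-1}^*(z)=z^{n-1}\overline{\Phi_{n-1}(1/\overline z)}$, and for $z\in\mathbb{C}\setminus\mathbb{T}$ put $$G_n(z)=\frac1{2\pi\mathrm i}\int_{\mathbb{T}}\frac{\Phi_n(t)}{t-z}\,\frac{\nu(t)}{t^n}\,dt,\qquad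 G_{n-1}^*(z)=\frac1{2\pi\mathrm i}\int_{\mathbb{T}}\frac{\Phi_{n-1}^*(t)}{t-z}\,\frac{\nu(t)}{t^n}\,dt .$$ Then, for every $n\ge1$, the functions $G_n$ and $G_{n-1}^*$ are holomorphic on $\mathbb{C}\setminus\mathbb{T}$, and the following hypergeometric differential equations hold, the first and the third for all $z\in\mathbb{C}$, the second and the fourth for all $z\in\mathbb{C}\setminus\mathbb{T}$: $$z(1-z)\Phi_n''(z)+[(n-b-2)z+(1-n-\overline b)]\,\Phi_n'(z)+n(1+b)\,\Phi_n(z)=0,$$ $$z(1-z)G_n''(z)+[(b-n-2)z+(1+n+\overline b)]\,G_n'(z)+b(1+n)\,G_n(z)=0,$$ $$z(1-z)(\Phi_{n-1}^*)''(z)+[(n-b-2)z+(1-n-\overline b)]\,(\Phi_{n-1}^*)'(z)+b(n-1)\,\Phi_{n-1}^*(z)=0,$$ $$z(1-z)(G_{n-1}^*)''(z)+[(b-n-2)z+(1+n+\overline b)]\,(G_{n-1}^*)'(z)+n(b-1)\,G_{n-1}^*(z)=0.$$ -/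

import Mathlib

open Polynomial ComplexConjugate

noncomputable section

/-- The modified Jacobi weight `ν(z) = (-z)^(-b̄) (1-z)^(b+b̄)` on the unit circle, with principal
powers. At `z = exp(iθ)`, `0 < θ < 2π`, `b = λ + iη`, it equals
`exp(-η(θ-π)) (2 sin(θ/2))^(2λ) > 0`. -/
def jacobiWeight (b z : ℂ) : ℂ :=
  (-z) ^ (-conj b) * (1 - z) ^ (b + conj b)

/-- `Φ` is the sequence of monic orthogonal polynomials on the unit circle for the measure
`dμ(z) = ν(z) / (i z) dz`: `Φ n` is monic of degree `n` and
`∫ Φ_n conj(Φ_m) dμ = κ_n⁻² δ_{n,m}` with `κ_n > 0`. -/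
structure IsMonicOrthogonalSequence (ν : ℂ → ℂ) (Φ : ℕ → ℂ[X]) : Prop where
  monic : ∀ n, (Φ n).Monic
  natDegree_eq : ∀ n, (Φ n).natDegree = n
  orthogonal : ∃ κ : ℕ → ℝ, (∀ n, 0 < κ n) ∧ ∀ n m,
    (∮ z in C(0, 1), (Φ n).eval z * conj ((Φ m).eval z) * (ν z / (Complex.I * z))) =
      if n = m then ((κ n : ℂ) ^ 2)⁻¹ else 0

/-- The reciprocal polynomial `p^*(z) = z^n conj(p(1/z̄))` of a polynomial of degree at most `n`. -/
def reciprocalPoly (n : ℕ) (p : ℂ[X]) : ℂ[X] :=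
  (p.reflect n).map (starRingEnd ℂ)

theorem eval_reciprocalPoly (n : ℕ) (p : ℂ[X]) (hp : p.natDegree ≤ n) (z : ℂ) (hz : z ≠ 0) :
    (reciprocalPoly n p).eval z = z ^ n * conj (p.eval (1 / conj z)) := by
  have hz' : conj z ≠ 0 := (_root_.map_ne_zero _).2 hz
  let _ : Invertible (conj z)⁻¹ := ⟨conj z, mul_inv_cancel₀ hz', inv_mul_cancel₀ hz'⟩
  have h := eval₂_reflect_mul_pow (RingHom.id ℂ) (conj z)⁻¹ n p hp
  have h2 : (p.reflect n).eval (conj z) = (conj z) ^ n * p.eval (1 / conj z) := by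
    rw [eval₂_id, eval₂_id] at h
    change (p.reflect n).eval (conj z) * _ = _ at h
    rw [one_div, ← h, mul_left_comm, ← mul_pow, mul_inv_cancel₀ hz', one_pow, mul_one]
  have h3 : (reciprocalPoly n p).eval z = conj ((p.reflect n).eval (conj z)) := by
    rw [reciprocalPoly, eval_map, ← eval₂_at_apply, Complex.conj_conj]
  rw [h3, h2]
  simp

/-- The Cauchy-type integral `(2πi)⁻¹ ∫_𝕋 p(t) / (t - z) · ν(t) / t^n dt`. -/
def associatedFunction (ν : ℂ → ℂ) (n : ℕ) (p : ℂ[X]) (z : ℂ) : ℂ :=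
  (2 * (Real.pi : ℂ) * Complex.I)⁻¹ * ∮ t in C(0, 1), p.eval t / (t - z) * (ν t / t ^ n)

end

/-!
Write `𝓛 = z(1-z) d²/dz² + (c - (a+b+1)z) d/dz - ab` for the hypergeometric operator. The weight
solves the Pearson equation `z(1-z) ν' = -(b̄ + b z) ν`, and `(1-z) ν` vanishes at `z = 1` from both
sides because `Re b > -1/2`. Hence, when `a + b + 1` and `c` are matched to the weight, `𝓛` is
symmetric for the bilinear pairing `∫ z^(1-n) f g dμ`, and on polynomials of degree less than `n`
that pairing is the inner product `⟨f, g⟩_μ` with `g` replaced by its reciprocal polynomial.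

For `a = -n` the operator maps polynomials of degree `n` to degree less than `n` and preserves lower
degrees, so `𝓛 Φ_n` is orthogonal to everything of degree less than `n`, itself included:
`𝓛 Φ_n = 0`. The equation for `Φ_n^*` is the same coefficient recurrence read backwards. Finally,
applied in `t` to the Cauchy kernel `1/(t-z)`, the operator with parameters `(a, b, c)` agrees with
the one with parameters `(1-a, 1-b, 2-c)` applied in `z`; moving `𝓛` across the pairing therefore
turns each polynomial equation into one for the corresponding Cauchy integral.
-/

noncomputable section

open MeasureTheory Set
open Real (pi_pos two_pi_pos sqrt_pos sq_sqrt)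
open scoped Real

section MonicOrthogonal

theorem map_eq_zero_of_mem_degreeLT_of_monic {R S M : Type*} [Ring R] [Semiring S]
    [AddCommMonoid M] [Module S M] {σ : R →+* S} (f : R[X] →ₛₗ[σ] M) {Ψ : ℕ → R[X]}
    (hmonic : ∀ k, (Ψ k).Monic) (hdegree : ∀ k, (Ψ k).degree = k) {n : ℕ}
    (hf : ∀ k < n, f (Ψ k) = 0) {q : R[X]} (hq : q ∈ degreeLT R n) : f q = 0 := by
  let S : Polynomial.Sequence R := ⟨Ψ, hdegree⟩
  have hspan : degreeLT R n ≤ LinearMap.ker f := by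
    rw [← S.span_degreeLT fun k _ ↦ (hmonic k).leadingCoeff ▸ isUnit_one, Submodule.span_le]
    rintro _ ⟨k, hk, rfl⟩
    exact hf k hk
  exact hspan hq

variable {K : Type*} [Field K] {σ : K →+* K} {B : K[X] →ₗ[K] K[X] →ₛₗ[σ] K} {n : ℕ} {p q : K[X]}

/-- `p` is a monic polynomial of degree `n` that is orthogonal to all polynomials of lower degree
with respect to the sesquilinear form `B`. -/
structure IsMonicOrthogonal (B : K[X] →ₗ[K] K[X] →ₛₗ[σ] K) (n : ℕ) (p : K[X]) : Prop where
  monic : p.Monic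
  degree_eq : p.degree = n
  orthogonal : ∀ q ∈ degreeLT K n, B p q = 0

theorem IsMonicOrthogonal.eq (hB : ∀ p, B p p = 0 → p = 0) (hp : IsMonicOrthogonal B n p)
    (hq : IsMonicOrthogonal B n q) : p = q := by
  have hsub : p - q ∈ degreeLT K n := by
    rw [mem_degreeLT, ← hp.degree_eq]
    exact degree_sub_lt_left (hp.degree_eq.trans hq.degree_eq.symm) hp.monic.ne_zero
      (hp.monic.leadingCoeff.trans hq.monic.leadingCoeff.symm)
  refine sub_eq_zero.1 (hB _ ?_)
  rw [LinearMap.map_sub₂, hp.orthogonal _ hsub, hq.orthogonal _ hsub, sub_zero]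

theorem exists_isMonicOrthogonal (hB : ∀ p, B p p = 0 → p = 0) (n : ℕ) :
    ∃ p, IsMonicOrthogonal B n p := by
  have orthogonal_of_forall_X_pow {p q : K[X]} (hp : ∀ i < n, B p (X ^ i) = 0)
      (hq : q ∈ degreeLT K n) : B p q = 0 :=
    map_eq_zero_of_mem_degreeLT_of_monic (B p) monic_X_pow degree_X_pow hp hq
  let moments : degreeLT K n →ₗ[K] (Fin n → K) :=
    LinearMap.pi fun i ↦ (B.flip (X ^ (i : ℕ))).domRestrict (degreeLT K n)
  have moments_injective : Function.Injective moments := by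
    refine (injective_iff_map_eq_zero moments).2 fun p hp ↦ Subtype.ext (hB _ ?_)
    exact orthogonal_of_forall_X_pow (fun i hi ↦ congrFun hp ⟨i, hi⟩) p.2
  have : FiniteDimensional K (degreeLT K n) := (degreeLTEquiv K n).symm.finiteDimensional
  have moments_surjective : Function.Surjective moments :=
    (LinearMap.injective_iff_surjective_of_finrank_eq_finrank (degreeLTEquiv K n).finrank_eq).1
      moments_injective
  obtain ⟨⟨q, hq⟩, hqX⟩ := moments_surjective fun i ↦ B (X ^ n) (X ^ (i : ℕ))
  have hdegree : q.degree < (X ^ n : K[X]).degree := by rwa [degree_X_pow, ← mem_degreeLT]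
  refine ⟨X ^ n - q, (monic_X_pow n).sub_of_left hdegree, ?_,
    fun r hr ↦ orthogonal_of_forall_X_pow (fun i hi ↦ ?_) hr⟩
  · rw [degree_sub_eq_left_of_degree_lt hdegree, degree_X_pow]
  · rw [LinearMap.map_sub₂, sub_eq_zero]
    exact (congrFun hqX ⟨i, hi⟩).symm

theorem existsUnique_isMonicOrthogonal (hB : ∀ p, B p p = 0 → p = 0) (n : ℕ) :
    ∃! p, IsMonicOrthogonal B n p :=
  existsUnique_of_exists_of_unique (exists_isMonicOrthogonal hB n) fun _ _ hp hq ↦ hp.eq hB hq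

end MonicOrthogonal

section PolyHypergeometric

variable {R : Type*} [CommRing R]

/-- The hypergeometric operator `z(1-z) d²/dz² + (c - (a+b+1)z) d/dz - ab` on polynomials. -/
def polyHypergeometricOp (a b c : R) (p : R[X]) : R[X] :=
  X * (1 - X) * derivative (derivative p) + (C c - C (a + b + 1) * X) * derivative p -
    C (a * b) * p

theorem eval_polyHypergeometricOp (a b c : R) (p : R[X]) (x : R) :
    (polyHypergeometricOp a b c p).eval x =
      x * (1 - x) * (derivative (derivative p)).eval x +
        (c - (a + b + 1) * x) * (derivative p).eval x - a * b * p.eval x := by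
  simp only [polyHypergeometricOp, eval_sub, eval_add, eval_mul, eval_X, eval_C, eval_one]

theorem coeff_polyHypergeometricOp (a b c : R) (p : R[X]) (k : ℕ) :
    (polyHypergeometricOp a b c p).coeff k =
      (k + 1) * (k + c) * p.coeff (k + 1) - (k + a) * (k + b) * p.coeff k := by
  have expand : polyHypergeometricOp a b c p =
      X * derivative (derivative p) - X * (X * derivative (derivative p)) +
        C c * derivative p - C (a + b + 1) * (X * derivative p) - C (a * b) * p := by
    rw [polyHypergeometricOp]; ring
  rw [expand]
  simp only [coeff_sub, coeff_add, coeff_C_mul]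
  rcases k with _ | _ | k
  · simp [coeff_derivative, mul_comm]
  · simp [coeff_derivative, coeff_X_mul]
    ring
  · simp only [coeff_X_mul, coeff_derivative]
    push_cast
    ring

theorem polyHypergeometricOp_mem_degreeLT (a b c : R) {n : ℕ} {p : R[X]}
    (hp : p ∈ degreeLT R n) : polyHypergeometricOp a b c p ∈ degreeLT R n := by
  rw [mem_degreeLT, degree_lt_iff_coeff_zero] at hp ⊢
  intro k hk
  rw [coeff_polyHypergeometricOp, hp k hk, hp (k + 1) (by omega), mul_zero, mul_zero, sub_zero]

theorem polyHypergeometricOp_neg_natCast_mem_degreeLT (b c : R) {n : ℕ} {p : R[X]}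
    (hp : p ∈ degreeLT R (n + 1)) : polyHypergeometricOp (-(n : R)) b c p ∈ degreeLT R n := by
  have hop := polyHypergeometricOp_mem_degreeLT (-(n : R)) b c hp
  rw [mem_degreeLT, degree_lt_iff_coeff_zero] at hp hop ⊢
  intro k hk
  rcases hk.eq_or_lt with rfl | hk
  · rw [coeff_polyHypergeometricOp, hp _ le_rfl]
    ring
  · exact hop k hk

theorem coeff_reciprocalPoly (N : ℕ) (p : ℂ[X]) (k : ℕ) :
    (reciprocalPoly N p).coeff k = conj (p.coeff (revAt N k)) := by
  rw [reciprocalPoly, coeff_map, coeff_reflect]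

theorem reciprocalPoly_mem_degreeLT {N : ℕ} {p : ℂ[X]} (hp : p ∈ degreeLT ℂ (N + 1)) :
    reciprocalPoly N p ∈ degreeLT ℂ (N + 1) := by
  rw [mem_degreeLT, degree_lt_iff_coeff_zero] at hp ⊢
  intro k hk
  rw [coeff_reciprocalPoly, revAt_eq_self_of_lt (by omega), hp k hk, map_zero]

theorem reciprocalPoly_reciprocalPoly (N : ℕ) (p : ℂ[X]) :
    reciprocalPoly N (reciprocalPoly N p) = p := by
  ext k
  rw [coeff_reciprocalPoly, coeff_reciprocalPoly, revAt_invol, Complex.conj_conj]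

theorem polyHypergeometricOp_reciprocalPoly_eq_zero {b c : ℂ} {N : ℕ} {p : ℂ[X]}
    (hp : p ∈ degreeLT ℂ (N + 1)) (h : polyHypergeometricOp (-N : ℂ) b c p = 0) :
    polyHypergeometricOp (-N : ℂ) (1 - N - conj c) (1 - N - conj b) (reciprocalPoly N p) = 0 := by
  ext k
  rcases lt_or_ge k N with hk | hk
  · obtain ⟨m, rfl⟩ : ∃ m, N = m + 1 + k := ⟨N - (k + 1), by omega⟩
    have recurrence := congrArg (fun q ↦ conj (q.coeff m)) h
    simp only [coeff_polyHypergeometricOp, coeff_zero, map_zero, map_sub, map_mul, map_add,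
      map_neg, map_one, map_natCast] at recurrence
    rw [coeff_polyHypergeometricOp, coeff_reciprocalPoly, coeff_reciprocalPoly,
      revAt_le (by omega), revAt_le (by omega), show m + 1 + k - (k + 1) = m by omega,
      show m + 1 + k - k = m + 1 by omega, coeff_zero]
    push_cast at recurrence ⊢
    linear_combination -recurrence
  · have hmem := polyHypergeometricOp_neg_natCast_mem_degreeLT (1 - N - conj c) (1 - N - conj b)
      (reciprocalPoly_mem_degreeLT hp)
    exact (degree_lt_iff_coeff_zero _ _).1 (mem_degreeLT.1 hmem) k hk

end PolyHypergeometric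

section CircleForm

instance measurableSpaceCircle : MeasurableSpace Circle := borel Circle

instance borelSpaceCircle : BorelSpace Circle := ⟨rfl⟩

variable {μ : Measure Circle} [IsFiniteMeasure μ]

theorem integrable_of_continuous_circle {E : Type*} [NormedAddCommGroup E] {f : Circle → E}
    (hf : Continuous f) : Integrable f μ :=
  hf.integrable_of_hasCompactSupport (HasCompactSupport.of_compactSpace f)

theorem integrable_eval_mul_conj_eval (p q : ℂ[X]) :
    Integrable (fun z : Circle ↦ p.eval (z : ℂ) * conj (q.eval (z : ℂ))) μ :=
  integrable_of_continuous_circle (by fun_prop)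

theorem eq_zero_of_forall_eval_circle {p : ℂ[X]} (h : ∀ z : Circle, p.eval (z : ℂ) = 0) :
    p = 0 := by
  have hinj : Set.InjOn (fun θ ↦ (Circle.exp θ : ℂ)) (Set.Ico 0 (2 * π)) :=
    Circle.coe_injective.comp_injOn (Circle.exp_injOn_Ico (sub_zero _).le)
  refine p.eq_zero_of_infinite_isRoot (((Set.Ico_infinite two_pi_pos).image hinj).mono ?_)
  rintro _ ⟨θ, -, rfl⟩
  exact h _

variable (μ) in
/-- The sesquilinear form `⟨p, q⟩ = ∫ p conj(q) dμ` of a finite measure on the unit circle. -/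
def circleForm : ℂ[X] →ₗ[ℂ] ℂ[X] →ₗ⋆[ℂ] ℂ :=
  LinearMap.mk₂'ₛₗ (RingHom.id ℂ) (starRingEnd ℂ)
    (fun p q ↦ ∫ z : Circle, p.eval (z : ℂ) * conj (q.eval (z : ℂ)) ∂μ)
    (fun p p' q ↦ by
      simp only [eval_add, add_mul]
      exact integral_add (integrable_eval_mul_conj_eval p q) (integrable_eval_mul_conj_eval p' q))
    (fun c p q ↦ by simp [mul_assoc, integral_const_mul])
    (fun p q q' ↦ by
      simp only [eval_add, map_add, mul_add]
      exact integral_add (integrable_eval_mul_conj_eval p q) (integrable_eval_mul_conj_eval p q'))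
    (fun c p q ↦ by simp [mul_left_comm _ (conj c), integral_const_mul])

theorem circleForm_apply (p q : ℂ[X]) :
    circleForm μ p q = ∫ z : Circle, p.eval (z : ℂ) * conj (q.eval (z : ℂ)) ∂μ :=
  rfl

theorem conj_circleForm (p q : ℂ[X]) : conj (circleForm μ p q) = circleForm μ q p := by
  simp [circleForm_apply, ← integral_conj, mul_comm]

theorem circleForm_self (p : ℂ[X]) :
    circleForm μ p p = ((∫ z : Circle, ‖p.eval (z : ℂ)‖ ^ 2 ∂μ : ℝ) : ℂ) := by
  simp only [circleForm_apply, Complex.mul_conj', ← Complex.ofReal_pow, integral_complex_ofReal]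

theorem integral_norm_eval_sq_pos [μ.IsOpenPosMeasure] {p : ℂ[X]} (hp : p ≠ 0) :
    0 < ∫ z : Circle, ‖p.eval (z : ℂ)‖ ^ 2 ∂μ := by
  obtain ⟨z, hz⟩ : ∃ z : Circle, p.eval (z : ℂ) ≠ 0 := by
    by_contra! h
    exact hp (eq_zero_of_forall_eval_circle h)
  exact Continuous.integral_pos_of_hasCompactSupport_nonneg_nonzero (x := z) (by fun_prop)
    (HasCompactSupport.of_compactSpace _) (fun _ ↦ by positivity) (by simpa using hz)

theorem eq_zero_of_circleForm_self_eq_zero [μ.IsOpenPosMeasure] (p : ℂ[X])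
    (h : circleForm μ p p = 0) : p = 0 := by
  by_contra hp
  rw [circleForm_self] at h
  exact (integral_norm_eval_sq_pos (μ := μ) hp).ne' (Complex.ofReal_eq_zero.1 h)

theorem IsMonicOrthogonalSequence.isMonicOrthogonal {ν : ℂ → ℂ}
    (hν : ∀ p q : ℂ[X], (∮ z in C(0, 1), p.eval z * conj (q.eval z) * (ν z / (Complex.I * z))) =
      circleForm μ p q) {Φ : ℕ → ℂ[X]} (h : IsMonicOrthogonalSequence ν Φ) (n : ℕ) :
    IsMonicOrthogonal (circleForm μ) n (Φ n) := by
  have hdegree (k : ℕ) : (Φ k).degree = k := by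
    rw [degree_eq_natDegree (h.monic k).ne_zero, h.natDegree_eq]
  obtain ⟨κ, -, hκ⟩ := h.orthogonal
  refine ⟨h.monic n, hdegree n, fun q hq ↦
    map_eq_zero_of_mem_degreeLT_of_monic (circleForm μ (Φ n)) h.monic hdegree (fun k hk ↦ ?_) hq⟩
  rw [← hν, hκ, if_neg hk.ne']

theorem isMonicOrthogonalSequence_of_isMonicOrthogonal [μ.IsOpenPosMeasure] {ν : ℂ → ℂ}
    (hν : ∀ p q : ℂ[X], (∮ z in C(0, 1), p.eval z * conj (q.eval z) * (ν z / (Complex.I * z))) =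
      circleForm μ p q) {Φ : ℕ → ℂ[X]} (h : ∀ n, IsMonicOrthogonal (circleForm μ) n (Φ n)) :
    IsMonicOrthogonalSequence ν Φ := by
  let r (n : ℕ) : ℝ := ∫ z : Circle, ‖(Φ n).eval (z : ℂ)‖ ^ 2 ∂μ
  have hr (n : ℕ) : 0 < r n := integral_norm_eval_sq_pos (h n).monic.ne_zero
  have orthogonal_of_lt {m n : ℕ} (hmn : m < n) : circleForm μ (Φ n) (Φ m) = 0 :=
    (h n).orthogonal _ (mem_degreeLT.2 (by rw [(h m).degree_eq]; exact_mod_cast hmn))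
  refine ⟨fun n ↦ (h n).monic, fun n ↦ natDegree_eq_of_degree_eq_some (h n).degree_eq,
    fun n ↦ (√(r n))⁻¹, fun n ↦ inv_pos.2 (sqrt_pos.2 (hr n)), fun n m ↦ ?_⟩
  rw [hν]
  rcases lt_trichotomy n m with hnm | rfl | hmn
  · rw [if_neg hnm.ne, ← conj_circleForm, orthogonal_of_lt hnm, map_zero]
  · rw [if_pos rfl, circleForm_self, ← Complex.ofReal_pow, inv_pow, sq_sqrt (hr n).le,
      ← Complex.ofReal_inv, inv_inv]
  · rw [if_neg hmn.ne', orthogonal_of_lt hmn]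

theorem existsUnique_isMonicOrthogonalSequence [μ.IsOpenPosMeasure] {ν : ℂ → ℂ}
    (hν : ∀ p q : ℂ[X], (∮ z in C(0, 1), p.eval z * conj (q.eval z) * (ν z / (Complex.I * z))) =
      circleForm μ p q) : ∃! Φ : ℕ → ℂ[X], IsMonicOrthogonalSequence ν Φ := by
  have iff (Φ : ℕ → ℂ[X]) : IsMonicOrthogonalSequence ν Φ ↔
      ∀ n, IsMonicOrthogonal (circleForm μ) n (Φ n) :=
    ⟨fun h n ↦ h.isMonicOrthogonal hν n, isMonicOrthogonalSequence_of_isMonicOrthogonal hν⟩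
  simp only [iff]
  choose Φ hΦ hunique using
    existsUnique_isMonicOrthogonal (B := circleForm μ) eq_zero_of_circleForm_self_eq_zero
  exact ⟨Φ, hΦ, fun Ψ hΨ ↦ funext fun n ↦ hunique n (Ψ n) (hΨ n)⟩

theorem circleForm_eq_integral_zpow_mul (p : ℂ[X]) {q : ℂ[X]} {N : ℕ} (hq : q.natDegree ≤ N) :
    circleForm μ p q =
      ∫ z : Circle, (z : ℂ) ^ (-N : ℤ) *
        (p.eval (z : ℂ) * (reciprocalPoly N q).eval (z : ℂ)) ∂μ := by
  rw [circleForm_apply]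
  congr with z
  have conj_inv : 1 / conj (z : ℂ) = z := by
    rw [← Circle.coe_inv_eq_conj, Circle.coe_inv, one_div, inv_inv]
  rw [eval_reciprocalPoly N q hq z z.coe_ne_zero, conj_inv, zpow_neg, zpow_natCast]
  field_simp [z.coe_ne_zero]

theorem forall_circleForm_eq_zero_iff {n : ℕ} {p : ℂ[X]} :
    (∀ q ∈ degreeLT ℂ n, circleForm μ p q = 0) ↔ ∀ q ∈ degreeLT ℂ n,
      ∫ z : Circle, (z : ℂ) ^ (1 - n : ℤ) * (p.eval (z : ℂ) * q.eval (z : ℂ)) ∂μ = 0 := by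
  rcases n with _ | N
  · simp [mem_degreeLT, Nat.WithBot.lt_zero_iff]
  have natDegree_le {q : ℂ[X]} (hq : q ∈ degreeLT ℂ (N + 1)) : q.natDegree ≤ N :=
    natDegree_le_iff_degree_le.2 (mem_degreeLE.1 (degreeLT_succ_eq_degreeLE (R := ℂ) ▸ hq))
  rw [show (1 - (N + 1 : ℕ) : ℤ) = -N by push_cast; ring]
  refine ⟨fun h q hq ↦ ?_, fun h q hq ↦ ?_⟩
  · have hq' := reciprocalPoly_mem_degreeLT hq
    rw [← h _ hq', circleForm_eq_integral_zpow_mul p (natDegree_le hq'),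
      reciprocalPoly_reciprocalPoly]
  · rw [circleForm_eq_integral_zpow_mul p (natDegree_le hq), h _ (reciprocalPoly_mem_degreeLT hq)]

end CircleForm

section Hypergeometric

/-- The hypergeometric operator `z(1-z) d²/dz² + (c - (a+b+1)z) d/dz - ab` on functions. -/
def hypergeometricOp (a b c : ℂ) (f : ℂ → ℂ) (z : ℂ) : ℂ :=
  z * (1 - z) * deriv (deriv f) z + (c - (a + b + 1) * z) * deriv f z - a * b * f z

theorem hypergeometricOp_eval (a b c : ℂ) (p : ℂ[X]) (z : ℂ) :
    hypergeometricOp a b c (fun w ↦ p.eval w) z = (polyHypergeometricOp a b c p).eval z := by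
  have deriv_eval (q : ℂ[X]) : deriv (fun w ↦ q.eval w) = fun w ↦ (derivative q).eval w :=
    funext fun _ ↦ q.deriv
  rw [eval_polyHypergeometricOp, hypergeometricOp, deriv_eval, deriv_eval]

theorem hypergeometricOp_const_mul (a b c k : ℂ) (f : ℂ → ℂ) (z : ℂ) :
    hypergeometricOp a b c (fun w ↦ k * f w) z = k * hypergeometricOp a b c f z := by
  simp only [hypergeometricOp, deriv_const_mul_field']
  ring

theorem analyticOnNhd_hypergeometricOp (a b c : ℂ) {f : ℂ → ℂ} {S : Set ℂ}
    (hf : AnalyticOnNhd ℂ f S) : AnalyticOnNhd ℂ (hypergeometricOp a b c f) S := fun z hz ↦ by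
  have := hf z hz
  have := hf.deriv z hz
  have := hf.deriv.deriv z hz
  unfold hypergeometricOp
  fun_prop

end Hypergeometric

section Pearson

variable {μ : Measure Circle} {s t : ℂ}

theorem circle_coe_mem_sphere (z : Circle) : (z : ℂ) ∈ Metric.sphere (0 : ℂ) 1 :=
  z.2

theorem continuous_circle_of_analyticOnNhd {f : ℂ → ℂ}
    (hf : AnalyticOnNhd ℂ f (Metric.sphere 0 1)) : Continuous fun z : Circle ↦ f z :=
  hf.continuousOn.comp_continuous continuous_subtype_val circle_coe_mem_sphere

theorem analyticOnNhd_eval (p : ℂ[X]) (S : Set ℂ) : AnalyticOnNhd ℂ (fun z ↦ p.eval z) S :=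
  fun z _ ↦ p.differentiable.analyticAt z

/-- The weak form of a Pearson equation: the density `w` of `μ` with respect to arc length solves
`z (1 - z) w' = (t + (1 - s) z) w`, without boundary terms at `z = 1`. -/
def IsPearson (μ : Measure Circle) (s t : ℂ) : Prop :=
  ∀ h : ℂ → ℂ, AnalyticOnNhd ℂ h (Metric.sphere 0 1) →
    ∫ z : Circle, z * (1 - z) * deriv h z + (t - s * z) * h z ∂μ = 0

theorem IsPearson.integral_zpow_mul (hμ : IsPearson μ s t) (m : ℤ) {h : ℂ → ℂ}
    (hh : AnalyticOnNhd ℂ h (Metric.sphere 0 1)) :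
    ∫ z : Circle, (z : ℂ) ^ m * (z * (1 - z) * deriv h z + (t + m - (s + m) * z) * h z) ∂μ = 0 := by
  have hzpow : AnalyticOnNhd ℂ (fun z : ℂ ↦ z ^ m) (Metric.sphere 0 1) :=
    fun z hz ↦ analyticAt_id.zpow (ne_zero_of_mem_unit_sphere ⟨z, hz⟩)
  rw [← hμ _ (hzpow.mul hh)]
  congr with z
  have hz := circle_coe_mem_sphere z
  rw [deriv_fun_mul (hzpow z hz).differentiableAt (hh z hz).differentiableAt, deriv_zpow,
    zpow_sub_one₀ z.coe_ne_zero]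
  field_simp [z.coe_ne_zero]
  ring

variable [IsFiniteMeasure μ]

theorem integrable_zpow_mul_of_analyticOnNhd (m : ℤ) {f : ℂ → ℂ}
    (hf : AnalyticOnNhd ℂ f (Metric.sphere 0 1)) :
    Integrable (fun z : Circle ↦ (z : ℂ) ^ m * f z) μ :=
  integrable_of_continuous_circle <|
    (continuous_subtype_val.zpow₀ m fun z : Circle ↦ Or.inl z.coe_ne_zero).mul
      (continuous_circle_of_analyticOnNhd hf)

theorem IsPearson.integral_hypergeometricOp_mul (hμ : IsPearson μ s t) {a b c : ℂ} {m : ℤ}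
    (hs : s + m = a + b + 1) (ht : t + m = c) {f g : ℂ → ℂ}
    (hf : AnalyticOnNhd ℂ f (Metric.sphere 0 1)) (hg : AnalyticOnNhd ℂ g (Metric.sphere 0 1)) :
    ∫ z : Circle, (z : ℂ) ^ m * (hypergeometricOp a b c f z * g z) ∂μ =
      ∫ z : Circle, (z : ℂ) ^ m * (f z * hypergeometricOp a b c g z) ∂μ := by
  have wronskian := hμ.integral_zpow_mul m
    (h := fun z ↦ deriv f z * g z - f z * deriv g z) ((hf.deriv.mul hg).sub (hf.mul hg.deriv))
  rw [← sub_eq_zero, ← integral_sub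
    (integrable_zpow_mul_of_analyticOnNhd m ((analyticOnNhd_hypergeometricOp a b c hf).mul hg))
    (integrable_zpow_mul_of_analyticOnNhd m (hf.mul (analyticOnNhd_hypergeometricOp a b c hg))),
    ← wronskian]
  congr with z
  have hz := circle_coe_mem_sphere z
  have hf₀ := (hf z hz).differentiableAt
  have hf₁ := (hf.deriv z hz).differentiableAt
  have hg₀ := (hg z hz).differentiableAt
  have hg₁ := (hg.deriv z hz).differentiableAt
  rw [deriv_fun_sub (hf₁.fun_mul hg₀) (hf₀.fun_mul hg₁), deriv_fun_mul hf₁ hg₀,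
    deriv_fun_mul hf₀ hg₁, hs, ht]
  simp only [hypergeometricOp]
  ring

theorem IsPearson.polyHypergeometricOp_eq_zero [μ.IsOpenPosMeasure] (hμ : IsPearson μ s t) {n : ℕ}
    {p : ℂ[X]} (hp : IsMonicOrthogonal (circleForm μ) n p) :
    polyHypergeometricOp (-n : ℂ) s (t + 1 - n) p = 0 := by
  set L := polyHypergeometricOp (-n : ℂ) s (t + 1 - n) with hL
  have hLp : L p ∈ degreeLT ℂ n := by
    refine polyHypergeometricOp_neg_natCast_mem_degreeLT _ _ (mem_degreeLT.2 ?_)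
    rw [hp.degree_eq]
    exact_mod_cast n.lt_succ_self
  refine eq_zero_of_circleForm_self_eq_zero (μ := μ) _
    (forall_circleForm_eq_zero_iff.2 (fun q hq ↦ ?_) _ hLp)
  have hLq : L q ∈ degreeLT ℂ n := polyHypergeometricOp_mem_degreeLT _ _ _ hq
  rw [← forall_circleForm_eq_zero_iff.1 hp.orthogonal _ hLq]
  simp only [hL, ← hypergeometricOp_eval]
  exact hμ.integral_hypergeometricOp_mul (by push_cast; ring) (by push_cast; ring)
    (analyticOnNhd_eval p _) (analyticOnNhd_eval q _)

end Pearson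

section CauchyTransform

variable {μ : Measure Circle} {g : Circle → ℂ} {z : ℂ}

/-- The Cauchy transform `z ↦ ∫ g(t) / (t - z) dμ(t)` of the measure `g dμ` on the unit circle. -/
def cauchyTransform (μ : Measure Circle) (g : Circle → ℂ) (z : ℂ) : ℂ :=
  ∫ t : Circle, g t / (t - z) ∂μ

theorem circle_sub_ne_zero (t : Circle) (hz : z ∉ Metric.sphere (0 : ℂ) 1) : (t : ℂ) - z ≠ 0 :=
  sub_ne_zero.2 fun h ↦ hz (h ▸ circle_coe_mem_sphere t)

theorem continuous_inv_circle_sub_pow (hz : z ∉ Metric.sphere (0 : ℂ) 1) (k : ℕ) :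
    Continuous fun t : Circle ↦ (((t : ℂ) - z) ^ k)⁻¹ :=
  ((continuous_subtype_val.sub continuous_const).pow k).inv₀
    fun t ↦ pow_ne_zero k (circle_sub_ne_zero t hz)

theorem exists_ball_forall_le_norm_circle_sub (hz : z ∉ Metric.sphere (0 : ℂ) 1) :
    ∃ δ > 0, ∀ w ∈ Metric.ball z δ, ∀ t : Circle, δ ≤ ‖(t : ℂ) - w‖ := by
  obtain ⟨ε, hε, hball⟩ := Metric.isOpen_iff.1 Metric.isClosed_sphere.isOpen_compl z hz
  refine ⟨ε / 2, half_pos hε, fun w hw t ↦ ?_⟩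
  have hwz : ‖w - z‖ < ε / 2 := mem_ball_iff_norm.1 hw
  have htz : ε ≤ ‖(t : ℂ) - z‖ := by
    by_contra! h
    exact hball (mem_ball_iff_norm.2 h) (circle_coe_mem_sphere t)
  linarith [norm_sub_le_norm_sub_add_norm_sub (t : ℂ) w z]

theorem integrable_div_circle_sub_pow (hg : Integrable g μ) (hz : z ∉ Metric.sphere (0 : ℂ) 1)
    (k : ℕ) : Integrable (fun t : Circle ↦ g t / (t - z) ^ k) μ := by
  obtain ⟨δ, hδ, hle⟩ := exists_ball_forall_le_norm_circle_sub hz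
  refine hg.mul_bdd (c := (δ ^ k)⁻¹)
    (continuous_inv_circle_sub_pow hz k).aestronglyMeasurable (.of_forall fun t ↦ ?_)
  rw [norm_inv, norm_pow]
  gcongr
  exact hle z (Metric.mem_ball_self hδ) t

theorem hasDerivAt_integral_div_circle_sub_pow (hg : Integrable g μ)
    (hz : z ∉ Metric.sphere (0 : ℂ) 1) (k : ℕ) :
    HasDerivAt (fun w ↦ ∫ t : Circle, g t / (t - w) ^ k ∂μ)
      (∫ t : Circle, k * (g t / (t - z) ^ (k + 1)) ∂μ) z := by
  obtain ⟨δ, hδ, hle⟩ := exists_ball_forall_le_norm_circle_sub hz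
  have ne_zero {w : ℂ} (hw : w ∈ Metric.ball z δ) (t : Circle) : (t : ℂ) - w ≠ 0 :=
    norm_pos_iff.1 (hδ.trans_le (hle w hw t))
  refine (hasDerivAt_integral_of_dominated_loc_of_deriv_le
    (F' := fun w t ↦ k * (g t / (t - w) ^ (k + 1)))
    (bound := fun t ↦ k * (‖g t‖ / δ ^ (k + 1)))
    (Metric.ball_mem_nhds z hδ) ?_ (integrable_div_circle_sub_pow hg hz k)
    ((integrable_div_circle_sub_pow hg hz (k + 1)).const_mul _).aestronglyMeasurable ?_
    ((hg.norm.div_const _).const_mul _) ?_).2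
  · filter_upwards [Metric.isClosed_sphere.isOpen_compl.mem_nhds hz] with w hw
    exact (integrable_div_circle_sub_pow hg hw k).aestronglyMeasurable
  · refine .of_forall fun t w hw ↦ ?_
    rw [norm_mul, norm_div, norm_pow, Complex.norm_natCast]
    gcongr
    exact hle w hw t
  · refine .of_forall fun t w hw ↦ ?_
    have hpow := ((hasDerivAt_id w).const_sub (t : ℂ)).fun_pow k
    refine ((hasDerivAt_const w (g t)).fun_div hpow (pow_ne_zero k (ne_zero hw t))).congr_deriv ?_
    rcases k with _ | k
    · simp
    · have := ne_zero hw t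
      simp only [id, Nat.add_sub_cancel]
      field_simp
      ring

theorem hasDerivAt_cauchyTransform (hg : Integrable g μ) (hz : z ∉ Metric.sphere (0 : ℂ) 1) :
    HasDerivAt (cauchyTransform μ g) (∫ t : Circle, g t / (t - z) ^ 2 ∂μ) z := by
  have h := hasDerivAt_integral_div_circle_sub_pow hg hz 1
  simp only [pow_one, Nat.cast_one, one_mul] at h
  exact h

theorem hasDerivAt_deriv_cauchyTransform (hg : Integrable g μ)
    (hz : z ∉ Metric.sphere (0 : ℂ) 1) :
    HasDerivAt (deriv (cauchyTransform μ g)) (∫ t : Circle, 2 * (g t / (t - z) ^ 3) ∂μ) z := by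
  refine (hasDerivAt_integral_div_circle_sub_pow hg hz 2).congr_of_eventuallyEq ?_
  filter_upwards [Metric.isClosed_sphere.isOpen_compl.mem_nhds hz] with w hw
  exact (hasDerivAt_cauchyTransform hg hw).deriv

theorem differentiableOn_cauchyTransform (hg : Integrable g μ) :
    DifferentiableOn ℂ (cauchyTransform μ g) (Metric.sphere 0 1)ᶜ := fun _ hz ↦
  (hasDerivAt_cauchyTransform hg hz).differentiableAt.differentiableWithinAt

theorem hypergeometricOp_inv_sub (a b c : ℂ) {z t : ℂ} (hzt : t - z ≠ 0) :
    hypergeometricOp a b c (fun u ↦ (u - z)⁻¹) t =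
      z * (1 - z) * (2 / (t - z) ^ 3) + ((2 - c) - (1 - a + (1 - b) + 1) * z) / (t - z) ^ 2 -
        (1 - a) * (1 - b) / (t - z) := by
  have deriv_kernel : deriv (fun u ↦ (u - z)⁻¹) = fun u ↦ -(u - z)⁻¹ ^ 2 := by
    ext u
    simp [deriv_comp_sub_const (f := fun v : ℂ ↦ v⁻¹)]
  have deriv_deriv_kernel : deriv (deriv fun u ↦ (u - z)⁻¹) t = 2 * (t - z)⁻¹ ^ 3 := by
    rw [deriv_kernel]
    refine ((((hasDerivAt_id t).sub_const z).fun_inv hzt).fun_pow 2).fun_neg.deriv.trans ?_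
    simp only [id, Nat.reduceSub, pow_one, Nat.cast_ofNat]
    field_simp
  rw [hypergeometricOp, deriv_deriv_kernel, deriv_kernel]
  field_simp
  ring

theorem hypergeometricOp_cauchyTransform (hg : Integrable g μ)
    (hz : z ∉ Metric.sphere (0 : ℂ) 1) (a b c : ℂ) :
    hypergeometricOp (1 - a) (1 - b) (2 - c) (cauchyTransform μ g) z =
      ∫ t : Circle, g t * hypergeometricOp a b c (fun u ↦ (u - z)⁻¹) t ∂μ := by
  have h₁ := (integrable_div_circle_sub_pow hg hz 1).const_mul ((1 - a) * (1 - b))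
  have h₂ := (integrable_div_circle_sub_pow hg hz 2).const_mul
    ((2 - c) - (1 - a + (1 - b) + 1) * z)
  have h₃ := ((integrable_div_circle_sub_pow hg hz 3).const_mul 2).const_mul (z * (1 - z))
  simp only [pow_one] at h₁
  rw [hypergeometricOp, (hasDerivAt_cauchyTransform hg hz).deriv,
    (hasDerivAt_deriv_cauchyTransform hg hz).deriv, cauchyTransform, ← integral_const_mul,
    ← integral_const_mul, ← integral_const_mul, ← integral_add h₃ h₂,
    ← integral_sub (h₃.fun_add h₂) h₁]
  congr with t
  rw [hypergeometricOp_inv_sub a b c (circle_sub_ne_zero t hz)]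
  ring

theorem IsPearson.hypergeometricOp_cauchyTransform_zpow_mul [IsFiniteMeasure μ] {s t : ℂ}
    (hμ : IsPearson μ s t) {a b c : ℂ} {m : ℤ} (hs : s + m = a + b + 1) (ht : t + m = c) {f : ℂ → ℂ}
    (hf : AnalyticOnNhd ℂ f (Metric.sphere 0 1)) (hz : z ∉ Metric.sphere (0 : ℂ) 1) :
    hypergeometricOp (1 - a) (1 - b) (2 - c) (cauchyTransform μ fun u ↦ u ^ m * f u) z =
      cauchyTransform μ (fun u ↦ u ^ m * hypergeometricOp a b c f u) z := by
  have hkernel : AnalyticOnNhd ℂ (fun u ↦ (u - z)⁻¹) (Metric.sphere 0 1) := fun u hu ↦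
    (analyticAt_id.sub analyticAt_const).inv (circle_sub_ne_zero ⟨u, hu⟩ hz)
  rw [hypergeometricOp_cauchyTransform (integrable_zpow_mul_of_analyticOnNhd m hf) hz]
  simp only [cauchyTransform, div_eq_mul_inv, mul_assoc]
  exact (hμ.integral_hypergeometricOp_mul hs ht hf hkernel).symm

end CauchyTransform

section JacobiWeight

/-- The modified Jacobi weight `ν(exp(iθ))` as a function of the angle `θ ∈ (0, 2π)`, where it is
real and positive. -/
def angularWeight (b : ℂ) (θ : ℝ) : ℝ :=
  Real.exp (-b.im * (θ - π)) * (2 * Real.sin (θ / 2)) ^ (2 * b.re)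

theorem two_mul_sin_half_pos {θ : ℝ} (hθ : θ ∈ Ioo 0 (2 * π)) : 0 < 2 * Real.sin (θ / 2) :=
  mul_pos two_pos (Real.sin_pos_of_pos_of_lt_pi (by linarith [hθ.1]) (by linarith [hθ.2]))

theorem angularWeight_pos (b : ℂ) {θ : ℝ} (hθ : θ ∈ Ioo 0 (2 * π)) : 0 < angularWeight b θ :=
  mul_pos (Real.exp_pos _) (Real.rpow_pos_of_pos (two_mul_sin_half_pos hθ) _)

theorem measurable_angularWeight (b : ℂ) : Measurable (angularWeight b) := by
  unfold angularWeight
  fun_prop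

theorem circleMap_zero_one : circleMap 0 1 = fun θ ↦ (Circle.exp θ : ℂ) := by
  ext θ
  rw [circleMap_zero, Complex.ofReal_one, one_mul, Circle.coe_exp]

theorem neg_circle_exp (θ : ℝ) :
    -(Circle.exp θ : ℂ) = Complex.exp ((θ - π : ℝ) * Complex.I) := by
  rw [Complex.ofReal_sub, sub_mul, Complex.exp_sub, Complex.exp_pi_mul_I, Circle.coe_exp, div_neg,
    div_one]

theorem one_sub_circle_exp (θ : ℝ) :
    1 - (Circle.exp θ : ℂ) =
      (2 * Real.sin (θ / 2) : ℝ) * Complex.exp (((θ - π) / 2 : ℝ) * Complex.I) := by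
  have hrot : Complex.exp (((θ - π) / 2 : ℝ) * Complex.I) =
      -Complex.I * Complex.exp (θ / 2 * Complex.I) := by
    rw [← Complex.exp_neg_pi_div_two_mul_I, ← Complex.exp_add]
    congr 1
    push_cast
    ring
  have hsq : (Circle.exp θ : ℂ) = Complex.exp (θ / 2 * Complex.I) ^ 2 := by
    rw [← Complex.exp_nat_mul, Circle.coe_exp]
    congr 1
    push_cast
    ring
  have hinv : Complex.exp (-(θ / 2) * Complex.I) * Complex.exp (θ / 2 * Complex.I) = 1 := by
    rw [← Complex.exp_add, neg_mul, neg_add_cancel, Complex.exp_zero]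
  rw [hrot, hsq]
  push_cast
  rw [Complex.sin]
  linear_combination Complex.I ^ 2 * hinv +
    (1 - Complex.exp (θ / 2 * Complex.I) ^ 2) * Complex.I_sq

theorem log_exp_ofReal_mul_I {x : ℝ} (hx : x ∈ Ioc (-π) π) :
    Complex.log (Complex.exp (x * Complex.I)) = x * Complex.I :=
  Complex.log_exp (by simpa using hx.1) (by simpa using hx.2)

theorem jacobiWeight_circle_exp (b : ℂ) {θ : ℝ} (hθ : θ ∈ Ioo 0 (2 * π)) :
    jacobiWeight b (Circle.exp θ) = angularWeight b θ := by
  have hsin := two_mul_sin_half_pos hθ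
  have hlog_neg := log_exp_ofReal_mul_I (x := θ - π) ⟨by linarith [hθ.1], by linarith [hθ.2]⟩
  have hlog_one_sub := log_exp_ofReal_mul_I (x := (θ - π) / 2)
    ⟨by linarith [hθ.1, pi_pos], by linarith [hθ.2, pi_pos]⟩
  have hexponent (L : ℝ) : (θ - π : ℝ) * Complex.I * -conj b +
      (L + ((θ - π) / 2 : ℝ) * Complex.I) * (b + conj b) =
        (-b.im * (θ - π) + L * (2 * b.re) : ℝ) := by
    apply Complex.ext <;> simp <;> ring
  rw [jacobiWeight, angularWeight, neg_circle_exp, one_sub_circle_exp,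
    Complex.cpow_def_of_ne_zero (Complex.exp_ne_zero _),
    Complex.cpow_def_of_ne_zero
      (mul_ne_zero (Complex.ofReal_ne_zero.2 hsin.ne') (Complex.exp_ne_zero _)),
    Complex.log_ofReal_mul hsin (Complex.exp_ne_zero _), hlog_neg, hlog_one_sub,
    Real.rpow_def_of_pos hsin, ← Real.exp_add, ← Complex.exp_add, hexponent, Complex.ofReal_exp]

theorem neg_circle_exp_mem_slitPlane {θ : ℝ} (hθ : θ ∈ Ioo 0 (2 * π)) :
    -(Circle.exp θ : ℂ) ∈ Complex.slitPlane := by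
  rw [neg_circle_exp, Complex.mem_slitPlane_iff_arg, ← Circle.coe_exp,
    Circle.arg_exp (by linarith [hθ.1]) (by linarith [hθ.2])]
  exact ⟨by linarith [hθ.2], Circle.coe_ne_zero _⟩

theorem hasDerivAt_jacobiWeight (b : ℂ) {z : ℂ} (hz : -z ∈ Complex.slitPlane) :
    HasDerivAt (jacobiWeight b) (-(conj b + b * z) / (z * (1 - z)) * jacobiWeight b z) z := by
  have hz' : 1 - z ∈ Complex.slitPlane := by
    rw [Complex.mem_slitPlane_iff] at hz ⊢
    refine hz.imp (fun h ↦ ?_) fun h ↦ ?_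
    · simp only [Complex.neg_re, Complex.sub_re, Complex.one_re] at h ⊢
      linarith
    · simpa using h
  have hz₀ : z ≠ 0 := neg_ne_zero.1 (Complex.slitPlane_ne_zero hz)
  have hz₁ : 1 - z ≠ 0 := Complex.slitPlane_ne_zero hz'
  refine (((hasDerivAt_neg z).cpow_const hz).fun_mul
    (((hasDerivAt_id z).const_sub 1).cpow_const hz')).congr_deriv ?_
  simp only [id]
  rw [Complex.cpow_sub _ _ (neg_ne_zero.2 hz₀), Complex.cpow_sub _ _ hz₁, jacobiWeight,
    Complex.cpow_one, Complex.cpow_one]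
  field_simp
  ring

theorem continuousOn_one_sub_circle_exp_mul_angularWeight {b : ℂ} (hb : -1 / 2 < b.re) :
    ContinuousOn (fun θ : ℝ ↦ (1 - Circle.exp θ : ℂ) * angularWeight b θ) (Icc 0 (2 * π)) := by
  have hcont : Continuous fun θ : ℝ ↦ Complex.exp (((θ - π) / 2 : ℝ) * Complex.I) *
      ((Real.exp (-b.im * (θ - π)) * (2 * Real.sin (θ / 2)) ^ (2 * b.re + 1) : ℝ) : ℂ) := by
    refine .mul (by fun_prop) (Complex.continuous_ofReal.comp (.mul (by fun_prop) ?_))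
    exact .rpow_const (by fun_prop) fun _ ↦ .inr (by linarith)
  refine hcont.continuousOn.congr fun θ hθ ↦ ?_
  have hsin : 0 ≤ Real.sin (θ / 2) :=
    Real.sin_nonneg_of_nonneg_of_le_pi (by linarith [hθ.1]) (by linarith [hθ.2])
  beta_reduce
  rw [one_sub_circle_exp, angularWeight, Real.rpow_add_one' (by positivity) (by linarith)]
  push_cast
  ring

theorem intervalIntegrable_two_mul_sin_half_rpow_zero_pi {r : ℝ} (hr : -1 < r) :
    IntervalIntegrable (fun θ ↦ (2 * Real.sin (θ / 2)) ^ r) volume 0 π := by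
  rcases le_or_gt 0 r with h | h
  · exact (Continuous.rpow_const (by fun_prop) fun _ ↦ .inr h).intervalIntegrable _ _
  have hbound : IntervalIntegrable (fun x : ℝ ↦ (2 / π * x) ^ r) volume 0 π := by
    refine ((intervalIntegral.intervalIntegrable_rpow' hr).const_mul ((2 / π) ^ r)).congr ?_
    intro x hx
    rw [uIoc_of_le pi_pos.le] at hx
    beta_reduce
    rw [Real.mul_rpow (by positivity) hx.1.le]
  refine hbound.mono_fun (Measurable.aestronglyMeasurable (by fun_prop)) ?_
  rw [uIoc_of_le pi_pos.le]
  filter_upwards [ae_restrict_mem measurableSet_Ioc] with x hx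
  have hlinear : 0 < 2 / π * x := mul_pos (by positivity) hx.1
  have hsin : 2 / π * x ≤ 2 * Real.sin (x / 2) := by
    linarith [Real.mul_le_sin (x := x / 2) (by linarith [hx.1]) (by linarith [hx.2])]
  rw [Real.norm_of_nonneg (Real.rpow_nonneg (hlinear.le.trans hsin) _),
    Real.norm_of_nonneg (Real.rpow_nonneg hlinear.le _)]
  exact Real.rpow_le_rpow_of_nonpos hlinear hsin h.le

theorem intervalIntegrable_two_mul_sin_half_rpow {r : ℝ} (hr : -1 < r) :
    IntervalIntegrable (fun θ ↦ (2 * Real.sin (θ / 2)) ^ r) volume 0 (2 * π) := by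
  have hleft := intervalIntegrable_two_mul_sin_half_rpow_zero_pi hr
  have hright := (hleft.comp_sub_left (2 * π)).symm
  simp only [sub_zero, sub_div, mul_div_cancel_left₀ π two_ne_zero, Real.sin_pi_sub] at hright
  exact hleft.trans (by convert hright using 1; ring)

theorem intervalIntegrable_angularWeight {b : ℂ} (hb : -1 / 2 < b.re) :
    IntervalIntegrable (angularWeight b) volume 0 (2 * π) :=
  (intervalIntegrable_two_mul_sin_half_rpow (r := 2 * b.re) (by linarith)).continuousOn_mul
    (by fun_prop)

/-- The measure `ν(z) / (i z) dz` on the unit circle: the image of `ν(exp(iθ)) dθ` on `(0, 2π)`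
under `θ ↦ exp(iθ)`. -/
def jacobiMeasure (b : ℂ) : Measure Circle :=
  ((volume.restrict (Ioo 0 (2 * π))).withDensity
    fun θ ↦ ENNReal.ofReal (angularWeight b θ)).map Circle.exp

theorem isFiniteMeasure_jacobiMeasure {b : ℂ} (hb : -1 / 2 < b.re) :
    IsFiniteMeasure (jacobiMeasure b) :=
  have := isFiniteMeasure_withDensity_ofReal ((intervalIntegrable_iff_integrableOn_Ioo_of_le
    two_pi_pos.le).1 (intervalIntegrable_angularWeight hb)).hasFiniteIntegral
  Measure.isFiniteMeasure_map _ _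

instance isOpenPosMeasure_jacobiMeasure (b : ℂ) : (jacobiMeasure b).IsOpenPosMeasure where
  open_pos U hU hU' := by
    have hpre : IsOpen (Circle.exp ⁻¹' U) := hU.preimage Circle.exp.continuous
    obtain ⟨z, hz⟩ := hU'
    obtain ⟨θ, hθ, rfl⟩ : ∃ θ ∈ Ico 0 (2 * π), Circle.exp θ = z := by
      obtain ⟨θ, hθ, h⟩ := Circle.periodic_exp.exists_mem_Ico₀ two_pi_pos (z : ℂ).arg
      exact ⟨θ, hθ, h.symm.trans (Circle.exp_arg z)⟩
    have hclosure : θ ∈ closure (Ioo 0 (2 * π)) := by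
      rw [closure_Ioo two_pi_pos.ne]
      exact Ico_subset_Icc_self hθ
    have hpos := (hpre.inter isOpen_Ioo).measure_ne_zero volume
      (mem_closure_iff.1 hclosure _ hpre hz)
    have hmeas : Measurable fun θ ↦ ENNReal.ofReal (angularWeight b θ) :=
      (measurable_angularWeight b).ennreal_ofReal
    rw [jacobiMeasure, Measure.map_apply (by fun_prop) hU.measurableSet, Ne,
      withDensity_apply_eq_zero hmeas, Measure.restrict_apply' measurableSet_Ioo]
    refine fun h ↦ hpos (measure_mono_null (fun φ hφ ↦ ?_) h)
    exact ⟨⟨(ENNReal.ofReal_pos.2 (angularWeight_pos b hφ.2)).ne', hφ.1⟩, hφ.2⟩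

theorem integral_jacobiMeasure (b : ℂ) {f : Circle → ℂ} (hf : Measurable f) :
    ∫ z, f z ∂jacobiMeasure b = ∫ θ in 0..2 * π, f (Circle.exp θ) * angularWeight b θ := by
  rw [jacobiMeasure, integral_map (by fun_prop) hf.aestronglyMeasurable,
    integral_withDensity_eq_integral_toReal_smul (measurable_angularWeight b).ennreal_ofReal
      (.of_forall fun _ ↦ ENNReal.ofReal_lt_top),
    intervalIntegral.integral_of_le two_pi_pos.le, integral_Ioc_eq_integral_Ioo]
  refine setIntegral_congr_fun measurableSet_Ioo fun θ hθ ↦ ?_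
  simp only [ENNReal.toReal_ofReal (angularWeight_pos b hθ).le, Complex.real_smul, mul_comm]

theorem circleIntegral_mul_jacobiWeight (b : ℂ) {f : ℂ → ℂ}
    (hf : Measurable fun z : Circle ↦ f z) :
    (∮ z in C(0, 1), f z * jacobiWeight b z) =
      ∫ z : Circle, Complex.I * z * f z ∂jacobiMeasure b := by
  have hIzf : Measurable fun z : Circle ↦ Complex.I * z * f z :=
    Measurable.mul (by fun_prop) hf
  rw [integral_jacobiMeasure b hIzf, circleIntegral,
    intervalIntegral.integral_of_le two_pi_pos.le, intervalIntegral.integral_of_le two_pi_pos.le,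
    integral_Ioc_eq_integral_Ioo, integral_Ioc_eq_integral_Ioo]
  refine setIntegral_congr_fun measurableSet_Ioo fun θ hθ ↦ ?_
  simp only [deriv_circleMap]
  simp only [circleMap_zero_one, jacobiWeight_circle_exp b hθ, smul_eq_mul]
  ring

theorem hasDerivAt_one_sub_circle_exp_mul_angularWeight_mul (b : ℂ) {h : ℂ → ℂ} {θ : ℝ}
    (hθ : θ ∈ Ioo 0 (2 * π)) (hh : DifferentiableAt ℂ h (Circle.exp θ)) :
    HasDerivAt (fun φ : ℝ ↦ (1 - Circle.exp φ : ℂ) * angularWeight b φ * h (Circle.exp φ))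
      (Complex.I * ((Circle.exp θ * (1 - Circle.exp θ) * deriv h (Circle.exp θ) +
        (-conj b - (1 + b) * Circle.exp θ) * h (Circle.exp θ)) * angularWeight b θ)) θ := by
  have hexp : HasDerivAt (fun φ : ℝ ↦ (Circle.exp φ : ℂ)) (Circle.exp θ * Complex.I) θ := by
    simpa only [circleMap_zero_one] using hasDerivAt_circleMap 0 1 θ
  have hslit := neg_circle_exp_mem_slitPlane hθ
  have hz := Circle.coe_ne_zero (Circle.exp θ)
  have hz₁ : 1 - (Circle.exp θ : ℂ) ≠ 0 := by
    rw [one_sub_circle_exp]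
    exact mul_ne_zero (Complex.ofReal_ne_zero.2 (two_mul_sin_half_pos hθ).ne')
      (Complex.exp_ne_zero _)
  have hcircle := (((hasDerivAt_id _).const_sub 1).fun_mul
    (hasDerivAt_jacobiWeight b hslit)).fun_mul hh.hasDerivAt |>.comp θ hexp
  refine (hcircle.congr_of_eventuallyEq ?_).congr_deriv ?_
  · filter_upwards [isOpen_Ioo.mem_nhds hθ] with φ hφ
    simp only [Function.comp, id, jacobiWeight_circle_exp b hφ]
  · simp only [id, jacobiWeight_circle_exp b hθ]
    field_simp
    ring

theorem isPearson_jacobiMeasure {b : ℂ} (hb : -1 / 2 < b.re) :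
    IsPearson (jacobiMeasure b) (1 + b) (-conj b) := by
  intro h hh
  set k : ℂ → ℂ := fun z ↦ z * (1 - z) * deriv h z + (-conj b - (1 + b) * z) * h z
  have hh_cont := continuous_circle_of_analyticOnNhd hh
  have hk_cont : Continuous fun z : Circle ↦ k z := by
    refine continuous_circle_of_analyticOnNhd fun z hz ↦ ?_
    have := hh z hz
    have := hh.deriv z hz
    fun_prop
  have hint : IntervalIntegrable
      (fun θ ↦ Complex.I * (k (Circle.exp θ) * angularWeight b θ)) volume 0 (2 * π) := by
    have hw := intervalIntegrable_angularWeight hb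
    refine (IntervalIntegrable.continuousOn_mul ⟨hw.1.ofReal, hw.2.ofReal⟩ ?_).const_mul _
    exact (hk_cont.comp Circle.exp.continuous).continuousOn
  have hFTC := intervalIntegral.integral_eq_sub_of_hasDerivAt_of_le two_pi_pos.le
    ((continuousOn_one_sub_circle_exp_mul_angularWeight hb).mul
      (hh_cont.comp Circle.exp.continuous).continuousOn)
    (fun θ hθ ↦ hasDerivAt_one_sub_circle_exp_mul_angularWeight_mul b hθ
      (hh _ (circle_coe_mem_sphere _)).differentiableAt) hint
  rw [intervalIntegral.integral_const_mul, ← integral_jacobiMeasure b hk_cont.measurable] at hFTC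
  simpa using hFTC

theorem circleIntegral_eq_circleForm_jacobiMeasure (b : ℂ) [IsFiniteMeasure (jacobiMeasure b)]
    (p q : ℂ[X]) :
    (∮ z in C(0, 1), p.eval z * conj (q.eval z) * (jacobiWeight b z / (Complex.I * z))) =
      circleForm (jacobiMeasure b) p q := by
  have hmeas : Measurable fun z : Circle ↦
      p.eval (z : ℂ) * conj (q.eval (z : ℂ)) * (Complex.I * z)⁻¹ := by
    fun_prop
  have h := circleIntegral_mul_jacobiWeight b
    (f := fun z ↦ p.eval z * conj (q.eval z) * (Complex.I * z)⁻¹) hmeas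
  simp only [mul_assoc, ← div_eq_inv_mul] at h ⊢
  rw [h, circleForm_apply]
  congr with z
  field_simp [z.coe_ne_zero]

theorem associatedFunction_eq_const_mul_cauchyTransform (b : ℂ) (n : ℕ) (p : ℂ[X]) :
    associatedFunction (jacobiWeight b) n p = fun z ↦ (2 * π : ℂ)⁻¹ *
      cauchyTransform (jacobiMeasure b) (fun t ↦ t ^ (1 - n : ℤ) * p.eval (t : ℂ)) z := by
  ext z
  have hmeas : Measurable fun t : Circle ↦ p.eval (t : ℂ) / (t - z) * ((t : ℂ) ^ n)⁻¹ := by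
    fun_prop
  have h := circleIntegral_mul_jacobiWeight b
    (f := fun t ↦ p.eval t / (t - z) * (t ^ n)⁻¹) hmeas
  simp only [mul_assoc, ← div_eq_inv_mul] at h
  rw [associatedFunction, h, cauchyTransform, mul_inv, mul_assoc, ← integral_const_mul]
  congr with t
  rw [zpow_sub₀ t.coe_ne_zero, zpow_one, zpow_natCast]
  field_simp [t.coe_ne_zero]

theorem differentiableOn_associatedFunction (b : ℂ) [IsFiniteMeasure (jacobiMeasure b)] (n : ℕ)
    (p : ℂ[X]) :
    DifferentiableOn ℂ (associatedFunction (jacobiWeight b) n p) (Metric.sphere 0 1)ᶜ := by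
  rw [associatedFunction_eq_const_mul_cauchyTransform]
  exact (differentiableOn_cauchyTransform
    (integrable_zpow_mul_of_analyticOnNhd _ (analyticOnNhd_eval p _))).const_mul _

theorem hypergeometricOp_associatedFunction_eq_zero {b : ℂ} (hb : -1 / 2 < b.re) {n : ℕ}
    {α β γ : ℂ} (hαβ : 2 + b - n = α + β + 1) (hγ : 1 - n - conj b = γ) {p : ℂ[X]}
    (hp : polyHypergeometricOp α β γ p = 0) {z : ℂ} (hz : z ∉ Metric.sphere (0 : ℂ) 1) :
    hypergeometricOp (1 - α) (1 - β) (2 - γ) (associatedFunction (jacobiWeight b) n p) z = 0 := by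
  have := isFiniteMeasure_jacobiMeasure hb
  have hs : 1 + b + (1 - n : ℤ) = α + β + 1 := by
    rw [← hαβ]
    push_cast
    ring
  have ht : -conj b + (1 - n : ℤ) = γ := by
    rw [← hγ]
    push_cast
    ring
  rw [associatedFunction_eq_const_mul_cauchyTransform, hypergeometricOp_const_mul,
    (isPearson_jacobiMeasure hb).hypergeometricOp_cauchyTransform_zpow_mul hs ht
      (analyticOnNhd_eval p _) hz]
  simp [hypergeometricOp_eval, hp, cauchyTransform]

end JacobiWeight

theorem IsMonicOrthogonalSequence.polyHypergeometricOp_eq_zero {b : ℂ} (hb : -1 / 2 < b.re)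
    {Φ : ℕ → ℂ[X]} (hΦ : IsMonicOrthogonalSequence (jacobiWeight b) Φ) (n : ℕ) :
    polyHypergeometricOp (-n : ℂ) (1 + b) (1 - n - conj b) (Φ n) = 0 := by
  have := isFiniteMeasure_jacobiMeasure hb
  have h := (isPearson_jacobiMeasure hb).polyHypergeometricOp_eq_zero
    (hΦ.isMonicOrthogonal (circleIntegral_eq_circleForm_jacobiMeasure b) n)
  rwa [show -conj b + 1 - n = 1 - n - conj b by ring] at h

theorem IsMonicOrthogonalSequence.polyHypergeometricOp_reciprocalPoly_eq_zero {b : ℂ}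
    (hb : -1 / 2 < b.re) {Φ : ℕ → ℂ[X]} (hΦ : IsMonicOrthogonalSequence (jacobiWeight b) Φ)
    (N : ℕ) :
    polyHypergeometricOp (-N : ℂ) b (-N - conj b) (reciprocalPoly N (Φ N)) = 0 := by
  have hmem : Φ N ∈ degreeLT ℂ (N + 1) := by
    rw [mem_degreeLT, degree_eq_natDegree (hΦ.monic N).ne_zero, hΦ.natDegree_eq]
    exact_mod_cast N.lt_succ_self
  have h := _root_.polyHypergeometricOp_reciprocalPoly_eq_zero hmem
    (hΦ.polyHypergeometricOp_eq_zero hb N)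
  convert h using 1
  simp only [map_sub, map_add, map_one, map_natCast, Complex.conj_conj]
  congr 1 <;> ring

end

theorem mainTheorem12 (b : ℂ) (hb : -1 / 2 < b.re) :
    (∃! Φ : ℕ → ℂ[X], IsMonicOrthogonalSequence (jacobiWeight b) Φ) ∧
    ∀ Φ : ℕ → ℂ[X], IsMonicOrthogonalSequence (jacobiWeight b) Φ →
    ∀ n : ℕ, 1 ≤ n →
    ∀ Φs : ℂ[X], Φs = reciprocalPoly (n - 1) (Φ (n - 1)) →
    ∀ G Gs : ℂ → ℂ, G = associatedFunction (jacobiWeight b) n (Φ n) →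
      Gs = associatedFunction (jacobiWeight b) n Φs →
    (∀ z : ℂ,
      z * (1 - z) * (derivative (derivative (Φ n))).eval z
        + ((n - b - 2) * z + (1 - n - conj b)) * (derivative (Φ n)).eval z
        + n * (1 + b) * (Φ n).eval z = 0) ∧
    (DifferentiableOn ℂ G (Metric.sphere 0 1)ᶜ ∧
      ∀ z ∉ Metric.sphere (0 : ℂ) 1,
        z * (1 - z) * deriv (deriv G) z
          + ((b - n - 2) * z + (1 + n + conj b)) * deriv G z
          + b * (1 + n) * G z = 0) ∧
    (∀ z : ℂ,
      z * (1 - z) * (derivative (derivative Φs)).eval z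
        + ((n - b - 2) * z + (1 - n - conj b)) * (derivative Φs).eval z
        + b * (n - 1) * Φs.eval z = 0) ∧
    (DifferentiableOn ℂ Gs (Metric.sphere 0 1)ᶜ ∧
      ∀ z ∉ Metric.sphere (0 : ℂ) 1,
        z * (1 - z) * deriv (deriv Gs) z
          + ((b - n - 2) * z + (1 + n + conj b)) * deriv Gs z
          + n * (b - 1) * Gs z = 0) := by
  have hfin := isFiniteMeasure_jacobiMeasure hb
  refine ⟨existsUnique_isMonicOrthogonalSequence (circleIntegral_eq_circleForm_jacobiMeasure b), ?_⟩
  rintro Φ hΦ n hn _ rfl _ _ rfl rfl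
  have hΦn := hΦ.polyHypergeometricOp_eq_zero hb n
  have hΦs := hΦ.polyHypergeometricOp_reciprocalPoly_eq_zero hb (n - 1)
  rw [Nat.cast_sub hn, Nat.cast_one] at hΦs
  refine ⟨fun z ↦ ?_, ⟨differentiableOn_associatedFunction b n _, fun z hz ↦ ?_⟩, fun z ↦ ?_,
    ⟨differentiableOn_associatedFunction b n _, fun z hz ↦ ?_⟩⟩
  · have h := congrArg (eval z) hΦn
    rw [eval_polyHypergeometricOp, eval_zero] at h
    linear_combination h
  · have h := hypergeometricOp_associatedFunction_eq_zero hb (by ring) (by ring) hΦn hz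
    rw [hypergeometricOp] at h
    linear_combination h
  · have h := congrArg (eval z) hΦs
    rw [eval_polyHypergeometricOp, eval_zero] at h
    linear_combination h
  · have h := hypergeometricOp_associatedFunction_eq_zero hb (by ring) (by ring) hΦs hz
    rw [hypergeometricOp] at h
    linear_combination h
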